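/- A subshift is a nonempty closed subset $X\subseteq A^{\mathbb Z}$ ($A$ a finite discrete alphabet, product topology) invariant under the shift map $\sigma$, $\sigma(x)[i]=x[i+1]$, i.e. $\sigma(X)=X$. Two subshifts are conjugate if there is a bijective sliding block code between them, i.e. a bijection $F$ for which there are integers $m\le a$ and a local rule $f$ with $F(x)[i]=f(x[i+m],\dots,x[i+a])$ for all $x$ and $i$. The product $Y\times Z$ of subshifts $Y\subseteq B^{\mathbb Z}$, $Z\subseteq C^{\mathbb Z}$ is regarded as a subshift of $(B\times C)^{\mathbb Z}$. A subshift $X$ is topologically direct prime if, whenever $X$ is conjugate to a product $Y\times Z$ of subshifts, $Y$ or $Z$ contains exactly one configuration. For a natural number $n>1$ let $M$ be the monoid with identity $1$ and zero element $0$ generated by $\{\alpha_1,\dots,\alpha_n,\beta_1,\dots,\beta_n\}\cup\{0\}$ subject to the relations $\alpha_i\beta_i=1$ and $\alpha_i\beta_j=0$ for $i\ne j$. The $n$-Dyck shift is $$D_n=\{x\in\{\alpha_1,\dots,\alpha_n,\beta_1,\dots,\beta_n\}^{\mathbb Z} \mid x[i]\cdot x[i+1]\cdots x[i+k]\ne 0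 \text{ in } M \text{ for all } i\in\mathbb Z,\ k\in\mathbb N\}.$$ Theorem. For every natural number $n>1$ the $n$-Dyck shift $D_n$ is topologically direct prime. -/

import Mathlib

open SymbolicDynamics.FullShift

universe u v w

namespace SymbolicDynamics

section Conjugacy

variable {A B C : Type*} [TopologicalSpace A] [TopologicalSpace B] [TopologicalSpace C]

/-- A map `F : X → Y` between sets of bi-infinite sequences is a sliding block code if, for some
memory `m` and anticipation `a` with `m ≤ a`, the symbol `F x i` is given by a local rule applied
to the window `x (i + m), …, x (i + a)`. -/
def IsSlidingBlockCode {A B : Type*} {X : Set (ℤ → A)} {Y : Set (ℤ → B)} (F : X → Y) : Prop :=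
  ∃ m a : ℤ, m ≤ a ∧ ∃ f : (Set.Icc m a → A) → B,
    ∀ (x : X) (i : ℤ), (F x : ℤ → B) i = f (fun j => (x : ℤ → A) (i + j))

/-- Two subshifts are conjugate if there is a bijective sliding block code between them. -/
def Conjugate (X : Subshift A ℤ) (Y : Subshift B ℤ) : Prop :=
  ∃ F : X.carrier → Y.carrier, Function.Bijective F ∧ IsSlidingBlockCode F

/-- The product `Y × Z`, as a subshift over the product alphabet. -/
def prodSubshift (Y : Subshift B ℤ) (Z : Subshift C ℤ) : Subshift (B × C) ℤ where
  carrier := {x | (fun i => (x i).1) ∈ Y.carrier ∧ (fun i => (x i).2) ∈ Z.carrier}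
  isClosed := by
    have h1 : Continuous fun (x : ℤ → B × C) (i : ℤ) => (x i).1 := by fun_prop
    have h2 : Continuous fun (x : ℤ → B × C) (i : ℤ) => (x i).2 := by fun_prop
    exact (Y.isClosed.preimage h1).inter (Z.isClosed.preimage h2)
  mapsTo := fun g _ hx => ⟨Y.mapsTo g hx.1, Z.mapsTo g hx.2⟩

/-- A subshift is trivial if it contains exactly one configuration. -/
def IsTrivial (X : Subshift A ℤ) : Prop := ∃ x, X.carrier = {x}

end Conjugacy

/-- A subshift `X` is (topologically) direct prime if, whenever `X` is conjugate to a product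
`Y × Z` of (nonempty) subshifts over finite discrete alphabets, `Y` or `Z` is trivial. -/
def IsDirectPrime {A : Type u} [TopologicalSpace A] (X : Subshift A ℤ) : Prop :=
  ∀ (B : Type v) [Finite B] [TopologicalSpace B] [DiscreteTopology B]
    (C : Type w) [Finite C] [TopologicalSpace C] [DiscreteTopology C]
    (Y : Subshift B ℤ) (Z : Subshift C ℤ), Y.carrier.Nonempty → Z.carrier.Nonempty →
    Conjugate X (prodSubshift Y Z) → IsTrivial Y ∨ IsTrivial Z

/-- The `2n` brackets: `Sum.inl i` is the left bracket `αᵢ`, `Sum.inr i` the right bracket `βᵢ`. -/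
abbrev Bracket (n : ℕ) : Type := Fin n ⊕ Fin n

/-- The defining relations of the Dyck monoid, on the generators `some b` (the brackets) and
`none` (the zero). -/
inductive DyckRel (n : ℕ) :
    FreeMonoid (Option (Bracket n)) → FreeMonoid (Option (Bracket n)) → Prop
  | cancel (i : Fin n) :
      DyckRel n (FreeMonoid.of (some (Sum.inl i)) * FreeMonoid.of (some (Sum.inr i))) 1
  | mismatch (i j : Fin n) (h : i ≠ j) :
      DyckRel n (FreeMonoid.of (some (Sum.inl i)) * FreeMonoid.of (some (Sum.inr j)))
        (FreeMonoid.of none)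
  | zero_mul (s : Option (Bracket n)) :
      DyckRel n (FreeMonoid.of none * FreeMonoid.of s) (FreeMonoid.of none)
  | mul_zero (s : Option (Bracket n)) :
      DyckRel n (FreeMonoid.of s * FreeMonoid.of none) (FreeMonoid.of none)

/-- The monoid generated by the brackets and a zero element, subject to `αᵢ βᵢ = 1` and
`αᵢ βⱼ = 0` for `i ≠ j`. -/
abbrev DyckMonoid (n : ℕ) : Type := PresentedMonoid (DyckRel n)

/-- The zero element of the Dyck monoid. -/
def DyckMonoid.zero (n : ℕ) : DyckMonoid n := PresentedMonoid.of (DyckRel n) none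

/-- A bracket as an element of the Dyck monoid. -/
def DyckMonoid.ofBracket {n : ℕ} (b : Bracket n) : DyckMonoid n :=
  PresentedMonoid.of (DyckRel n) (some b)

/-- The `n`-Dyck shift: the sequences of brackets `x` such that
`x i * x (i + 1) * ⋯ * x (i + k) ≠ 0` in the Dyck monoid, for all `i : ℤ` and `k : ℕ`. -/
def dyckShift (n : ℕ) : Subshift (Bracket n) ℤ where
  carrier := {x | ∀ (i : ℤ) (k : ℕ),
    (List.ofFn fun j : Fin (k + 1) => DyckMonoid.ofBracket (x (i + (j : ℕ)))).prod
      ≠ DyckMonoid.zero n}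
  isClosed := by
    simp only [Set.ofPred_forall]
    refine isClosed_iInter fun i => isClosed_iInter fun k => ?_
    have hc : Continuous fun (x : ℤ → Bracket n) (j : Fin (k + 1)) => x (i + (j : ℕ)) := by
      fun_prop
    exact (isClosed_discrete {y : Fin (k + 1) → Bracket n |
      (List.ofFn fun j => DyckMonoid.ofBracket (y j)).prod ≠ DyckMonoid.zero n}).preimage hc
  mapsTo := by
    intro g x hx i k
    have h := hx (g + i) k
    simpa only [shift_apply, add_assoc] using h

end SymbolicDynamics

/-! A sequence lies in the Dyck shift exactly when a bi-infinite sequence of infinite stacks can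
read it (`mem_dyckShift_iff`). Its rigidity is that no point runs from the constant sequence α_d to
the constant sequence β_c when c ≠ d. If both factors Y and Z joined the corresponding images of
these points, pairing the two connections would give such a point. Hence one factor, say Y, does not
join them (`ProductDecomposition.not_heteroclinic`).

Fix the Y-coordinate of the constant sequence β_c. The points with this coordinate form a closed
shift-invariant copy of Z. If the right ray of one of them never fell below its starting height, it
could follow the ray of α_d with no gap, and the first coordinate would give the forbidden
connection in Y. So every right ray of this fibre descends; by compactness it does so in bounded
time, and climbs are bounded. A left ray of bounded height can be continued, after a bounded gap, by
any right ray, so any two points of Z can be glued with a uniform gap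
(`ProductDecomposition.exists_uniform_glue`).

Now keep the Y-coordinate of a long mountain …α_d α_c^M β_c^M β_d… and splice a value of an
arbitrary point of Z into its Z-coordinate, changing only coordinates deep inside the rising block.
The rest of the mountain forces that block (`eq_mountain`), so nothing has changed. All points of Z
therefore agree at one coordinate and, by shift invariance, everywhere. -/

namespace SymbolicDynamics

/-! ### Stacks, the Dyck monoid and membership in the Dyck shift -/

/-- Infinite stacks over the alphabet `Fin n`, the top symbol at index `0`. -/
abbrev BracketStack (n : ℕ) : Type := ℕ → Fin n

/-- `BracketStack.Step s b t`: reading the bracket `b` transforms the stack `s` into `t`. A left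
bracket pushes its index, a right bracket pops its index. -/
def BracketStack.Step {n : ℕ} (s : BracketStack n) : Bracket n → BracketStack n → Prop
  | Sum.inl a, t => t 0 = a ∧ ∀ j, t (j + 1) = s j
  | Sum.inr a, t => s 0 = a ∧ ∀ j, s (j + 1) = t j

open BracketStack

namespace DyckMonoid

variable {n : ℕ}

/-- The left action of the generators of the Dyck monoid on stacks, where `none` stands for
failure: the stack before reading a bracket is computed from the stack after it. -/
def generatorAct : Option (Bracket n) → Function.End (Option (BracketStack n))
  | none => fun _ => none
  | some (Sum.inl a) => fun o => o.bind fun t => if t 0 = a then some (fun j => t (j + 1)) else none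
  | some (Sum.inr a) => fun o => o.map fun t j => j.casesOn a t

theorem _root_.Function.End.mul_apply {α : Type*} (f g : Function.End α) (a : α) :
    (f * g) a = f (g a) := rfl

open Function.End in
/-- The action of the Dyck monoid on stacks. -/
def stackAct (n : ℕ) : DyckMonoid n →* Function.End (Option (BracketStack n)) :=
  PresentedMonoid.lift generatorAct (by
    intro x y h
    induction h with
    | cancel i =>
      funext o
      rw [map_mul, mul_apply, map_one, Function.End.one_def]
      cases o <;> simp [generatorAct]
    | mismatch i j hij =>
      funext o
      rw [map_mul, mul_apply]
      cases o <;> simp [generatorAct, hij.symm]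
    | zero_mul s =>
      funext o
      rw [map_mul, mul_apply]
      simp [generatorAct]
    | mul_zero s =>
      funext o
      rw [map_mul, mul_apply]
      rcases s with _ | _ | _ <;> simp [generatorAct])

theorem stackAct_mul (x y : DyckMonoid n) (o : Option (BracketStack n)) :
    stackAct n (x * y) o = stackAct n x (stackAct n y o) := by
  rw [map_mul, Function.End.mul_apply]

theorem stackAct_zero (o : Option (BracketStack n)) : stackAct n (zero n) o = none := rfl

theorem stackAct_ofBracket_eq_some {b : Bracket n} {o : Option (BracketStack n)}
    {s : BracketStack n} :
    stackAct n (ofBracket b) o = some s ↔ ∃ t, o = some t ∧ Step s b t := by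
  change generatorAct (some b) o = some s ↔ _
  rcases b with a | a <;> rcases o with _ | t
  · simp [generatorAct]
  · simp only [generatorAct, Option.bind_some, Option.ite_none_right_eq_some, Option.some.injEq,
      Step, exists_eq_left']
    exact and_congr_right fun _ => funext_iff
  · simp [generatorAct]
  · simp only [generatorAct, Option.map_some, Option.some.injEq, Step, exists_eq_left']
    rw [funext_iff]
    constructor
    · intro h
      exact ⟨(h 0).symm, fun j => (h (j + 1)).symm⟩
    · rintro ⟨h0, h1⟩ (_ | j)
      · exact h0.symm
      · exact (h1 j).symm

theorem zero_mul_ofBracket (b : Bracket n) : zero n * ofBracket b = zero n :=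
  PresentedMonoid.mk_eq_mk_of_rel (DyckRel.zero_mul (some b))

theorem ofBracket_mul_zero (b : Bracket n) : ofBracket b * zero n = zero n :=
  PresentedMonoid.mk_eq_mk_of_rel (DyckRel.mul_zero (some b))

theorem inl_mul_inr (i : Fin n) :
    ofBracket (Sum.inl i : Bracket n) * ofBracket (Sum.inr i) = 1 :=
  PresentedMonoid.mk_eq_mk_of_rel (DyckRel.cancel i)

theorem inl_mul_inr_of_ne {i j : Fin n} (h : i ≠ j) :
    ofBracket (Sum.inl i : Bracket n) * ofBracket (Sum.inr j) = zero n :=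
  PresentedMonoid.mk_eq_mk_of_rel (DyckRel.mismatch i j h)

/-- The product of a list of brackets. -/
def listProd (l : List (Bracket n)) : DyckMonoid n := (l.map ofBracket).prod

theorem listProd_cons (b : Bracket n) (l : List (Bracket n)) :
    listProd (b :: l) = ofBracket b * listProd l := by
  simp [listProd]

theorem zero_mul_listProd (l : List (Bracket n)) : zero n * listProd l = zero n := by
  induction l with
  | nil => simp [listProd]
  | cons b l ih => rw [listProd_cons, ← mul_assoc, zero_mul_ofBracket, ih]

/-- A product of brackets is zero, or a product of right brackets followed by left brackets. -/
theorem listProd_eq_zero_or (l : List (Bracket n)) :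
    listProd l = zero n ∨ ∃ u v : List (Fin n),
      listProd l = listProd (u.map Sum.inr ++ v.map Sum.inl) := by
  induction l with
  | nil => exact Or.inr ⟨[], [], rfl⟩
  | cons b l ih =>
    rw [listProd_cons]
    rcases ih with ih | ⟨u, v, ih⟩
    · exact Or.inl (by rw [ih, ofBracket_mul_zero])
    rw [ih]
    rcases b with a | a
    · rcases u with _ | ⟨c, u⟩
      · exact Or.inr ⟨[], a :: v, by simp [listProd]⟩
      · rw [List.map_cons, List.cons_append, listProd_cons, ← mul_assoc]
        by_cases hac : a = c
        · subst hac
          exact Or.inr ⟨u, v, by rw [inl_mul_inr, one_mul]⟩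
        · exact Or.inl (by rw [inl_mul_inr_of_ne hac, zero_mul_listProd])
    · exact Or.inr ⟨a :: u, v, by simp [listProd]⟩

theorem exists_stackAct_inl (v : List (Fin n)) (s : BracketStack n) :
    ∃ t, stackAct n (listProd (v.map Sum.inl)) (some t) = some s := by
  induction v generalizing s with
  | nil => exact ⟨s, rfl⟩
  | cons a v ih =>
    obtain ⟨t, ht⟩ := ih (fun j => j.casesOn a s)
    refine ⟨t, ?_⟩
    rw [List.map_cons, listProd_cons, stackAct_mul, ht, stackAct_ofBracket_eq_some]
    exact ⟨_, rfl, rfl, fun _ => rfl⟩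

theorem exists_stackAct_inr_append_inl (hn : 0 < n) (u v : List (Fin n)) :
    ∃ t s, stackAct n (listProd (u.map Sum.inr ++ v.map Sum.inl)) (some t) = some s := by
  induction u with
  | nil =>
    obtain ⟨t, ht⟩ := exists_stackAct_inl v (fun _ => ⟨0, hn⟩)
    exact ⟨t, _, ht⟩
  | cons a u ih =>
    obtain ⟨t, s, h⟩ := ih
    refine ⟨t, fun j => j.casesOn a s, ?_⟩
    rw [List.map_cons, List.cons_append, listProd_cons, stackAct_mul, h,
      stackAct_ofBracket_eq_some]
    exact ⟨_, rfl, rfl, fun _ => rfl⟩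

/-- A nonzero product reduces to right brackets followed by left brackets, and such a word acts
without failure on a suitable stack; zero fails on every stack. -/
theorem listProd_ne_zero_iff (hn : 0 < n) (l : List (Bracket n)) :
    listProd l ≠ zero n ↔ ∃ t s, stackAct n (listProd l) (some t) = some s := by
  constructor
  · intro h
    rcases listProd_eq_zero_or l with h0 | ⟨u, v, h1⟩
    · exact absurd h0 h
    · rw [h1]
      exact exists_stackAct_inr_append_inl hn u v
  · rintro ⟨t, s, h⟩ h0
    rw [h0, stackAct_zero] at h
    cases h

theorem exists_steps_of_stackAct (x : ℤ → Bracket n) (k : ℕ) :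
    ∀ (i : ℤ) (t s : BracketStack n),
      stackAct n (listProd (List.ofFn fun j : Fin k => x (i + (j : ℕ)))) (some t) = some s →
      ∃ S : ℤ → BracketStack n, S i = s ∧
        ∀ j, i ≤ j → j < i + k → Step (S j) (x j) (S (j + 1)) := by
  induction k with
  | zero =>
    intro i t s _
    exact ⟨fun _ => s, rfl, fun j h1 h2 => by simp at h2; omega⟩
  | succ k ih =>
    intro i t s h
    rw [List.ofFn_succ, listProd_cons, stackAct_mul] at h
    obtain ⟨s', hs', hstep⟩ := stackAct_ofBracket_eq_some.1 h
    have e : (fun j : Fin k => x (i + ((j.succ : Fin (k + 1)) : ℕ))) =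
        fun j : Fin k => x (i + 1 + (j : ℕ)) := by
      funext j
      congr 1
      simp
      ring
    rw [e] at hs'
    obtain ⟨S, hS0, hS⟩ := ih (i + 1) t s' hs'
    refine ⟨Function.update S i s, Function.update_self .., fun j h1 h2 => ?_⟩
    rw [Function.update_of_ne (show j + 1 ≠ i by omega)]
    rcases eq_or_lt_of_le h1 with rfl | h3
    · rw [Function.update_self, hS0]
      simpa using hstep
    · rw [Function.update_of_ne (show j ≠ i by omega)]
      exact hS j (by omega) (by push_cast at h2; omega)

theorem stackAct_of_steps (x : ℤ → Bracket n) (S : ℤ → BracketStack n)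
    (hS : ∀ i, Step (S i) (x i) (S (i + 1))) (k : ℕ) :
    ∀ i : ℤ, stackAct n (listProd (List.ofFn fun j : Fin k => x (i + (j : ℕ))))
      (some (S (i + k))) = some (S i) := by
  induction k with
  | zero =>
    intro i
    simp [listProd]
    rfl
  | succ k ih =>
    intro i
    have e : (fun j : Fin k => x (i + ((j.succ : Fin (k + 1)) : ℕ))) =
        fun j : Fin k => x (i + 1 + (j : ℕ)) := by
      funext j
      congr 1
      simp
      ring
    rw [List.ofFn_succ, listProd_cons, stackAct_mul, e]
    have h := ih (i + 1)
    rw [show i + 1 + (k : ℤ) = i + ((k + 1 : ℕ) : ℤ) by push_cast; ring] at h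
    rw [h, stackAct_ofBracket_eq_some]
    exact ⟨_, rfl, by simpa using hS i⟩

end DyckMonoid

theorem BracketStack.isClosed_step {n : ℕ} (b : Bracket n) (i : ℤ) :
    IsClosed {S : ℤ → BracketStack n | Step (S i) b (S (i + 1))} := by
  rcases b with a | a
  · simp only [Step, Set.ofPred_and, Set.ofPred_forall]
    exact (isClosed_eq (by fun_prop) continuous_const).inter
      (isClosed_iInter fun j => isClosed_eq (by fun_prop) (by fun_prop))
  · simp only [Step, Set.ofPred_and, Set.ofPred_forall]
    exact (isClosed_eq (by fun_prop) continuous_const).inter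
      (isClosed_iInter fun j => isClosed_eq (by fun_prop) (by fun_prop))

/-- A sequence of brackets is in the Dyck shift if and only if it is read by a bi-infinite sequence
of stacks. -/
theorem mem_dyckShift_iff {n : ℕ} (hn : 0 < n) (x : ℤ → Bracket n) :
    x ∈ (dyckShift n).carrier ↔
      ∃ S : ℤ → BracketStack n, ∀ i, Step (S i) (x i) (S (i + 1)) := by
  have key : x ∈ (dyckShift n).carrier ↔ ∀ (i : ℤ) (k : ℕ), ∃ t s, DyckMonoid.stackAct n
      (DyckMonoid.listProd (List.ofFn fun j : Fin (k + 1) => x (i + (j : ℕ)))) (some t)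
        = some s := by
    refine forall₂_congr fun i k => ?_
    rw [← DyckMonoid.listProd_ne_zero_iff hn, DyckMonoid.listProd, List.map_ofFn]
    rfl
  rw [key]
  constructor
  · intro h
    -- Compactness: the stack sequences that read `x` correctly on [-k, k] form nested nonempty
    -- closed sets.
    let E : ℕ → Set (ℤ → BracketStack n) := fun k =>
      ⋂ i ∈ Set.Icc (-k : ℤ) k, {S | Step (S i) (x i) (S (i + 1))}
    have hcl : ∀ k, IsClosed (E k) := fun k =>
      isClosed_biInter fun i _ => isClosed_step (x i) i
    have hne : ∀ k, (E k).Nonempty := by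
      intro k
      obtain ⟨t, s, hts⟩ := h (-k) (2 * k)
      obtain ⟨S, -, hS⟩ := DyckMonoid.exists_steps_of_stackAct x _ _ t s hts
      refine ⟨S, Set.mem_iInter₂.2 fun i hi => hS i hi.1 ?_⟩
      have := hi.2
      push_cast
      omega
    have hmono : ∀ k, E (k + 1) ⊆ E k := fun k =>
      Set.biInter_subset_biInter_left (Set.Icc_subset_Icc (by push_cast; omega)
        (by push_cast; omega))
    obtain ⟨S, hS⟩ := IsCompact.nonempty_iInter_of_sequence_nonempty_isCompact_isClosed E hmono hne
      (hcl 0).isCompact hcl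
    refine ⟨S, fun i => ?_⟩
    have := Set.mem_iInter.1 hS i.natAbs
    exact Set.mem_iInter₂.1 this i ⟨by omega, by omega⟩
  · rintro ⟨S, hS⟩ i k
    exact ⟨_, _, DyckMonoid.stackAct_of_steps x S hS (k + 1) i⟩


/-! ### Stack heights and gluing of rays -/

section Gluing

variable {n : ℕ}

/-- The stack consisting of the top `k` symbols of `t` on top of `s`. -/
def BracketStack.graft (k : ℕ) (t s : BracketStack n) : BracketStack n :=
  fun j => if j < k then t j else s (j - k)

theorem BracketStack.graft_zero (t s : BracketStack n) : graft 0 t s = s := by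
  funext j
  simp [graft]

theorem BracketStack.Step.graft_inl {t t' : BracketStack n} {c : Fin n}
    (h : Step t (Sum.inl c) t') (k : ℕ) (s : BracketStack n) :
    Step (graft k t s) (Sum.inl c) (graft (k + 1) t' s) := by
  refine ⟨by simpa [graft] using h.1, fun j => ?_⟩
  simp [graft, h.2]

theorem BracketStack.Step.graft_inr {t t' : BracketStack n} {c : Fin n}
    (h : Step t (Sum.inr c) t') (k : ℕ) (s : BracketStack n) :
    Step (graft (k + 1) t s) (Sum.inr c) (graft k t' s) := by
  refine ⟨by simpa [graft] using h.1, fun j => ?_⟩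
  simp [graft, h.2]

theorem BracketStack.step_graft_drop (t s : BracketStack n) (d k : ℕ) :
    Step (graft k (fun j => t (j + (d + 1))) s) (Sum.inl (t d))
      (graft (k + 1) (fun j => t (j + d)) s) := by
  refine ⟨by simp [graft], fun j => ?_⟩
  simp only [graft, Nat.add_lt_add_iff_right, Nat.add_sub_add_right]
  congr 2
  omega

/-- The contribution of a bracket to the height of the stack. -/
def bracketSign : Bracket n → ℤ := Sum.elim (fun _ => 1) (fun _ => -1)

/-- The change of the height of the stack while reading `k` brackets of `x` from position `i`. -/
def heightChange (x : ℤ → Bracket n) (i : ℤ) (k : ℕ) : ℤ :=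
  ∑ j ∈ Finset.range k, bracketSign (x (i + j))

theorem heightChange_succ (x : ℤ → Bracket n) (i : ℤ) (k : ℕ) :
    heightChange x i (k + 1) = heightChange x i k + bracketSign (x (i + k)) :=
  Finset.sum_range_succ _ _

theorem heightChange_add (x : ℤ → Bracket n) (i : ℤ) (k l : ℕ) :
    heightChange x i (k + l) = heightChange x i k + heightChange x (i + k) l := by
  simp only [heightChange, Finset.sum_range_add, Nat.cast_add, add_assoc]

theorem heightChange_le (x : ℤ → Bracket n) (i : ℤ) (k : ℕ) : heightChange x i k ≤ k := by
  induction k with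
  | zero => simp [heightChange]
  | succ k ih =>
    rw [heightChange_succ]
    have : bracketSign (x (i + k)) ≤ 1 := by
      rcases x (i + k) with a | a <;> simp [bracketSign]
    push_cast
    omega

/-- A left ray and a right ray of brackets can be joined when they meet at a common stack. -/
theorem exists_mem_dyckShift_of_steps (hn : 0 < n) {p x : ℤ → Bracket n}
    {S U : ℤ → BracketStack n} {a : ℤ} (hS : ∀ i < a, Step (S i) (p i) (S (i + 1)))
    (hU : ∀ i ≥ a, Step (U i) (x i) (U (i + 1))) (h : S a = U a) :
    ∃ w ∈ (dyckShift n).carrier, (∀ i < a, w i = p i) ∧ ∀ i ≥ a, w i = x i := by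
  refine ⟨fun i => if i < a then p i else x i, ?_, fun i hi => if_pos hi,
    fun i hi => if_neg (by omega)⟩
  rw [mem_dyckShift_iff hn]
  refine ⟨fun i => if i ≤ a then S i else U i, fun i => ?_⟩
  rcases lt_trichotomy i a with hi | rfl | hi
  · simp only [if_pos hi, if_pos hi.le, if_pos (show i + 1 ≤ a by omega)]
    exact hS i hi
  · simp only [if_neg (lt_irrefl i), if_pos le_rfl, if_neg (show ¬ i + 1 ≤ i by omega), h]
    exact hU i le_rfl
  · simp only [if_neg (show ¬ i < a by omega), if_neg (show ¬ i ≤ a by omega),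
      if_neg (show ¬ i + 1 ≤ a by omega)]
    exact hU i hi.le

/-- If the right ray of `q` from `a` never goes more than `N` levels below its start, then its
stacks may be replaced by stacks with an arbitrary base below level `N`. -/
theorem exists_steps_graft {q : ℤ → Bracket n} {T : ℤ → BracketStack n}
    (hT : ∀ i, Step (T i) (q i) (T (i + 1))) {a : ℤ} {N : ℕ}
    (hN : ∀ m, -(N : ℤ) ≤ heightChange q a m) (s : BracketStack n) :
    ∃ U : ℤ → BracketStack n, U a = graft N (T a) s ∧
      ∀ i ≥ a, Step (U i) (q i) (U (i + 1)) := by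
  -- The number of symbols of `T i` still above the new base is `N` plus the height change; `hN`
  -- keeps it nonnegative, so `toNat` does not truncate.
  refine ⟨fun i => graft (N + heightChange q a (i - a).toNat).toNat (T i) s, ?_, fun i hi => ?_⟩
  · simp [heightChange]
  · obtain ⟨m, rfl⟩ : ∃ m : ℕ, i = a + m := ⟨(i - a).toNat, by omega⟩
    have h1 := hN m
    have h2 := hN (m + 1)
    have hstep := hT (a + m)
    have e1 : (a + m - a).toNat = m := by omega
    have e2 : (a + m + 1 - a).toNat = m + 1 := by omega
    simp only [e1, e2]
    rw [heightChange_succ] at h2 ⊢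
    rcases hq : q (a + m) with c | c <;> rw [hq] at h2 hstep <;>
      simp only [bracketSign, Sum.elim_inl, Sum.elim_inr] at h2 ⊢
    · have e : (N + (heightChange q a m + 1)).toNat = (N + heightChange q a m).toNat + 1 := by
        omega
      rw [e]
      exact hstep.graft_inl _ s
    · have e : (N + heightChange q a m).toNat = (N + (heightChange q a m + -1)).toNat + 1 := by
        omega
      rw [e]
      exact hstep.graft_inr _ s

/-- A left ray of the Dyck shift can be joined to a right ray that never goes more than `N` levels
below its start, with a gap of length `N`. -/
theorem exists_glue_of_heightChange_ge (hn : 0 < n) {p q : ℤ → Bracket n}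
    (hp : p ∈ (dyckShift n).carrier) (hq : q ∈ (dyckShift n).carrier) {a : ℤ} {N : ℕ}
    (hN : ∀ m, -(N : ℤ) ≤ heightChange q a m) :
    ∃ x ∈ (dyckShift n).carrier, (∀ i < a - N, x i = p i) ∧ ∀ i ≥ a, x i = q i := by
  obtain ⟨S, hS⟩ := (mem_dyckShift_iff hn p).1 hp
  obtain ⟨T, hT⟩ := (mem_dyckShift_iff hn q).1 hq
  -- The gap is built backwards from `a`: it pushes the top `N` symbols of `T a`, deepest first,
  -- onto the stack left by `p`. Undoing all `N` pushes leaves exactly `S (a - N)`.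
  have key : ∀ k ≤ N, ∃ (x : ℤ → Bracket n) (U : ℤ → BracketStack n), (∀ i ≥ a, x i = q i) ∧
      U (a - k) = graft (N - k) (fun j => T a (j + k)) (S (a - N)) ∧
      ∀ i ≥ a - k, Step (U i) (x i) (U (i + 1)) := by
    intro k
    induction k with
    | zero =>
      intro _
      obtain ⟨U, hU0, hU⟩ := exists_steps_graft hT hN (S (a - N))
      exact ⟨q, U, fun _ _ => rfl, by simpa using hU0, by simpa using hU⟩
    | succ k ih =>
      intro hk
      obtain ⟨x, U, hx, hU0, hU⟩ := ih (by omega)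
      refine ⟨Function.update x (a - k - 1) (Sum.inl (T a k)),
        Function.update U (a - k - 1) (graft (N - (k + 1)) (fun j => T a (j + (k + 1)))
          (S (a - N))), fun i hi => ?_, ?_, fun i hi => ?_⟩
      · rw [Function.update_of_ne (by omega), hx i hi]
      · rw [show a - ((k + 1 : ℕ) : ℤ) = a - k - 1 by push_cast; ring, Function.update_self]
      · push_cast at hi
        rw [Function.update_of_ne (show i + 1 ≠ a - k - 1 by omega)]
        by_cases hik : i = a - k - 1
        · subst hik
          rw [Function.update_self, Function.update_self, sub_add_cancel, hU0,
            show N - k = N - (k + 1) + 1 by omega]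
          exact step_graft_drop _ _ _ _
        · rw [Function.update_of_ne hik, Function.update_of_ne hik]
          exact hU i (by omega)
  obtain ⟨x, U, hx, hU0, hU⟩ := key N le_rfl
  rw [Nat.sub_self, graft_zero] at hU0
  obtain ⟨w, hw, hwp, hwx⟩ := exists_mem_dyckShift_of_steps hn (fun i _ => hS i) hU hU0.symm
  exact ⟨w, hw, hwp, fun i hi => by rw [hwx i (by omega), hx i hi]⟩

/-- Time reversal of a sequence of brackets. -/
def bracketReverse (x : ℤ → Bracket n) : ℤ → Bracket n := fun i => (x (-1 - i)).swap

theorem bracketReverse_bracketReverse (x : ℤ → Bracket n) :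
    bracketReverse (bracketReverse x) = x := by
  funext i
  simp [bracketReverse]

theorem BracketStack.Step.swap {s t : BracketStack n} {b : Bracket n} (h : Step s b t) :
    Step t b.swap s := by
  rcases b with a | a <;> exact ⟨h.1, h.2⟩

theorem bracketReverse_mem (hn : 0 < n) {x : ℤ → Bracket n} (hx : x ∈ (dyckShift n).carrier) :
    bracketReverse x ∈ (dyckShift n).carrier := by
  rw [mem_dyckShift_iff hn] at hx ⊢
  obtain ⟨S, hS⟩ := hx
  refine ⟨fun i => S (-i), fun i => ?_⟩
  have h := (hS (-1 - i)).swap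
  rw [show -1 - i + 1 = -i by ring, show -1 - i = -(i + 1) by ring] at h
  rw [bracketReverse, show -1 - i = -(i + 1) by ring]
  exact h

theorem heightChange_bracketReverse (x : ℤ → Bracket n) (i : ℤ) (k : ℕ) :
    heightChange (bracketReverse x) i k = -heightChange x (-i - k) k := by
  rw [heightChange, ← Finset.sum_range_reflect, heightChange, ← Finset.sum_neg_distrib]
  refine Finset.sum_congr rfl fun j hj => ?_
  have hj := Finset.mem_range.1 hj
  have e : -1 - (i + ((k - 1 - j : ℕ) : ℤ)) = -i - k + j := by omega
  rw [bracketReverse, e]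
  rcases x (-i - k + j) with c | c <;> simp [bracketSign]

/-- A left ray of stack height at most `L` can be joined to every right ray of the Dyck shift, with
a gap of length `L`. -/
theorem exists_glue_of_heightChange_le (hn : 0 < n) {p q : ℤ → Bracket n}
    (hp : p ∈ (dyckShift n).carrier) (hq : q ∈ (dyckShift n).carrier) {a : ℤ} {L : ℕ}
    (hL : ∀ m : ℕ, heightChange p (a - m) m ≤ L) :
    ∃ x ∈ (dyckShift n).carrier, (∀ i < a, x i = p i) ∧ ∀ i ≥ a + L, x i = q i := by
  -- Reversal exchanges pushes and pops, so bounded climbs ending at `a` become bounded descents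
  -- starting at `-a`.
  obtain ⟨x, hx, hxq, hxp⟩ := exists_glue_of_heightChange_ge hn (a := -a) (N := L)
    (bracketReverse_mem hn hq) (bracketReverse_mem hn hp) (fun m => by
      rw [heightChange_bracketReverse, neg_neg]
      exact neg_le_neg (hL m))
  refine ⟨bracketReverse x, bracketReverse_mem hn hx, fun i hi => ?_, fun i hi => ?_⟩
  · rw [bracketReverse, hxp _ (by omega)]
    exact congrFun (bracketReverse_bracketReverse p) i
  · rw [bracketReverse, hxq _ (by omega)]
    exact congrFun (bracketReverse_bracketReverse q) i

end Gluing

/-! ### Constant sequences and mountains -/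

section SpecialPoints

variable {n : ℕ}

theorem const_inl_mem (hn : 0 < n) (c : Fin n) :
    (fun _ => Sum.inl c : ℤ → Bracket n) ∈ (dyckShift n).carrier :=
  (mem_dyckShift_iff hn _).2 ⟨fun _ _ => c, fun _ => ⟨rfl, fun _ => rfl⟩⟩

theorem const_inr_mem (hn : 0 < n) (c : Fin n) :
    (fun _ => Sum.inr c : ℤ → Bracket n) ∈ (dyckShift n).carrier :=
  (mem_dyckShift_iff hn _).2 ⟨fun _ _ => c, fun _ => ⟨rfl, fun _ => rfl⟩⟩

/-- No point of the Dyck shift is left asymptotic to a constant sequence of left brackets and right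
asymptotic to a constant sequence of right brackets of another kind. -/
theorem eq_of_asymptotic_const (hn : 0 < n) {c d : Fin n} {x : ℤ → Bracket n}
    (hx : x ∈ (dyckShift n).carrier) {a b : ℤ} (hl : ∀ i < a, x i = Sum.inl c)
    (hr : ∀ i ≥ b, x i = Sum.inr d) : c = d := by
  obtain ⟨S, hS⟩ := (mem_dyckShift_iff hn x).1 hx
  have h1 : ∀ (j : ℕ) (i : ℤ), i ≤ a → S i j = c := by
    intro j
    induction j with
    | zero =>
      intro i hi
      have h := hS (i - 1)
      rw [hl _ (by omega), sub_add_cancel] at h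
      exact h.1
    | succ j ih =>
      intro i hi
      have h := hS (i - 1)
      rw [hl _ (by omega), sub_add_cancel] at h
      rw [h.2, ih _ (by omega)]
  have h2 : ∀ (j : ℕ) (i : ℤ), b ≤ i → S i j = d := by
    intro j
    induction j with
    | zero =>
      intro i hi
      have h := hS i
      rw [hr _ hi] at h
      exact h.1
    | succ j ih =>
      intro i hi
      have h := hS i
      rw [hr _ hi] at h
      rw [h.2, ih _ (by omega)]
  -- Each bracket shifts the stack by one place, so a tail of symbols `c` survives any finite
  -- stretch, whereas the stacks over the right tail consist of `d` only.
  have h3 : ∀ k : ℕ, ∃ l : ℕ, ∀ j, S (a + k) (j + l) = c := by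
    intro k
    induction k with
    | zero => exact ⟨0, fun j => h1 _ _ (by simp)⟩
    | succ k ih =>
      obtain ⟨l, hl⟩ := ih
      refine ⟨l + 1, fun j => ?_⟩
      have h := hS (a + k)
      rw [show a + ((k + 1 : ℕ) : ℤ) = a + k + 1 by push_cast; ring]
      rcases hxk : x (a + k) with e | e <;> rw [hxk] at h
      · rw [← add_assoc, h.2, hl]
      · rw [← h.2, show j + (l + 1) + 1 = j + 2 + l by ring, hl]
  obtain ⟨l, hl⟩ := h3 (b - a).toNat
  rw [← hl 0, h2 _ _ (by omega)]

/-- The sequence with left tail `d` (left brackets), a block of `M` left brackets `c`, a block of `M`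
right brackets `c`, and right tail `d` (right brackets). -/
def mountain (c d : Fin n) (M : ℕ) : ℤ → Bracket n := fun i =>
  if i < 0 then Sum.inl d else if i < M then Sum.inl c else if i < 2 * M then Sum.inr c
  else Sum.inr d

theorem mountain_mem (hn : 0 < n) (c d : Fin n) (M : ℕ) :
    mountain c d M ∈ (dyckShift n).carrier := by
  rw [mem_dyckShift_iff hn]
  -- Over a base of symbols `d`, the stack carries min(i, 2M - i) symbols `c`, when this is
  -- positive.
  refine ⟨fun i j => if (j : ℤ) < i ∧ j < 2 * M - i then c else d, fun i => ?_⟩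
  unfold mountain
  split_ifs with h1 h2 h3
  · exact ⟨if_neg (by omega), fun j => by
      dsimp only
      rw [if_neg (by omega), if_neg (by omega)]⟩
  · exact ⟨if_pos (by omega), fun j => if_congr (by omega) rfl rfl⟩
  · exact ⟨if_pos (by omega), fun j => if_congr (by omega) rfl rfl⟩
  · exact ⟨if_neg (by omega), fun j => by
      dsimp only
      rw [if_neg (by omega), if_neg (by omega)]⟩

/-- The rising block of `mountain c d M` is determined by the rest of the sequence. -/
theorem eq_mountain (hn : 0 < n) {c d : Fin n} (hcd : c ≠ d) {M : ℕ} {x : ℤ → Bracket n}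
    (hx : x ∈ (dyckShift n).carrier) (h : ∀ i : ℤ, i < 0 ∨ (M : ℤ) ≤ i → x i = mountain c d M i) :
    x = mountain c d M := by
  obtain ⟨S, hS⟩ := (mem_dyckShift_iff hn x).1 hx
  have h0 : ∀ (j : ℕ) (i : ℤ), i ≤ 0 → S i j = d := by
    intro j
    induction j with
    | zero =>
      intro i hi
      have h' := hS (i - 1)
      rw [h _ (by omega), sub_add_cancel, mountain, if_pos (by omega)] at h'
      exact h'.1
    | succ j ih =>
      intro i hi
      have h' := hS (i - 1)
      rw [h _ (by omega), sub_add_cancel, mountain, if_pos (by omega)] at h'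
      rw [h'.2, ih _ (by omega)]
  -- Within `k` steps after time 0, only the top `k` places can differ from `d`.
  have h1 : ∀ k : ℕ, k ≤ M → ∀ j, k ≤ j → S k j = d := by
    intro k
    induction k with
    | zero => exact fun _ j _ => h0 j _ le_rfl
    | succ k ih =>
      intro hk j hj
      have h' := hS k
      obtain ⟨j, rfl⟩ : ∃ j', j = j' + 1 := ⟨j - 1, by omega⟩
      push_cast
      rcases hxk : x k with e | e <;> rw [hxk] at h'
      · rw [h'.2, ih (by omega) j (by omega)]
      · rw [← h'.2, ih (by omega) _ (by omega)]
  -- The falling block pops only `c`, which fixes the top of the stack throughout it.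
  have h2 : ∀ (k j : ℕ), j < M - k → S (M + k) j = c := by
    intro k j
    induction j generalizing k with
    | zero =>
      intro hk
      have h' := hS (M + k)
      rw [h _ (by omega), mountain, if_neg (by omega), if_neg (by omega), if_pos (by omega)] at h'
      exact h'.1
    | succ j ih =>
      intro hk
      have h' := hS (M + k)
      rw [h _ (by omega), mountain, if_neg (by omega), if_neg (by omega), if_pos (by omega)] at h'
      rw [h'.2, add_assoc]
      exact ih (k + 1) (by omega)
  -- Backwards from the summit, each bracket removes at most one `c` from the top.
  have h3 : ∀ k : ℕ, k ≤ M → ∀ j, j < M - k → S (M - k) j = c := by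
    intro k
    induction k with
    | zero =>
      intro _ j hj
      simpa using h2 0 j hj
    | succ k ih =>
      intro hk j hj
      have h' := hS (M - (k + 1))
      rw [show (M : ℤ) - (k + 1) + 1 = M - k by ring] at h'
      push_cast
      rcases hxk : x (M - (k + 1)) with e | e <;> rw [hxk] at h'
      · rw [← h'.2, ih (by omega) _ (by omega)]
      · rcases j with _ | j
        -- After a pop here, the place holding `c` at depth `M - (k + 1)` would come from depth `M -
        -- k` one step earlier, where `h1` demands `d`.
        · by_contra hne
          have h4 := h1 (M - (k + 1)) (by omega) (M - (k + 1)) le_rfl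
          have h5 := ih (by omega) (M - (k + 1)) (by omega)
          rw [← h'.2] at h5
          have h6 := h1 (M - (k + 1)) (by omega) (M - (k + 1) + 1) (by omega)
          rw [Nat.cast_sub hk] at h6
          push_cast at h6
          exact hcd (h5.symm.trans h6)
        · rw [h'.2, ih (by omega) _ (by omega)]
  funext i
  by_cases hi : i < 0 ∨ (M : ℤ) ≤ i
  · exact h i hi
  push Not at hi
  obtain ⟨k, rfl⟩ : ∃ k : ℕ, i = k := ⟨i.toNat, by omega⟩
  have hk : k + 1 ≤ M := by omega
  have h' := hS k
  rw [mountain, if_neg (by omega), if_pos (by omega)]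
  have h5 : ∀ j, j < k + 1 → S (k + 1) j = c := by
    intro j hj
    have := h3 (M - (k + 1)) (by omega) j (by omega)
    rw [Nat.cast_sub hk] at this
    rwa [show (M : ℤ) - (M - ((k + 1 : ℕ) : ℤ)) = k + 1 by push_cast; ring] at this
  rcases hxk : x k with e | e <;> rw [hxk] at h'
  · rw [← h'.1, h5 0 (by omega)]
  · exfalso
    have h4 := h1 k (by omega) (k + 1) (by omega)
    rw [h'.2, h5 k (by omega)] at h4
    exact hcd h4

end SpecialPoints

/-! ### Product decompositions and local properties -/

section Decomposition

variable {A B C : Type*}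

/-- A decomposition of a set `X` of bi-infinite sequences as a product of `Y` and `Z`, by maps that
commute with the shift and are local with radius `r` in both directions. -/
structure ProductDecomposition (X : Set (ℤ → A)) (Y : Set (ℤ → B)) (Z : Set (ℤ → C)) where
  fst : (ℤ → A) → ℤ → B
  snd : (ℤ → A) → ℤ → C
  pair : (ℤ → B) → (ℤ → C) → ℤ → A
  r : ℕ
  fst_mem : ∀ x ∈ X, fst x ∈ Y
  snd_mem : ∀ x ∈ X, snd x ∈ Z
  pair_mem : ∀ y ∈ Y, ∀ z ∈ Z, pair y z ∈ X
  fst_pair : ∀ y ∈ Y, ∀ z ∈ Z, fst (pair y z) = y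
  snd_pair : ∀ y ∈ Y, ∀ z ∈ Z, snd (pair y z) = z
  pair_fst_snd : ∀ x ∈ X, pair (fst x) (snd x) = x
  fst_local : ∀ x ∈ X, ∀ x' ∈ X, ∀ i : ℤ, (∀ j, i - r ≤ j → j ≤ i + r → x j = x' j) →
    fst x i = fst x' i
  snd_local : ∀ x ∈ X, ∀ x' ∈ X, ∀ i : ℤ, (∀ j, i - r ≤ j → j ≤ i + r → x j = x' j) →
    snd x i = snd x' i
  pair_local : ∀ y ∈ Y, ∀ y' ∈ Y, ∀ z ∈ Z, ∀ z' ∈ Z, ∀ i : ℤ,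
    (∀ j, i - r ≤ j → j ≤ i + r → y j = y' j) → (∀ j, i - r ≤ j → j ≤ i + r → z j = z' j) →
    pair y z i = pair y' z' i
  fst_shift : ∀ x ∈ X, ∀ k : ℤ, fst (shift k x) = shift k (fst x)
  snd_shift : ∀ x ∈ X, ∀ k : ℤ, snd (shift k x) = shift k (snd x)

/-- Exchange of the two factors of a product decomposition. -/
def ProductDecomposition.swap {X : Set (ℤ → A)} {Y : Set (ℤ → B)} {Z : Set (ℤ → C)}
    (d : ProductDecomposition X Y Z) : ProductDecomposition X Z Y where
  fst := d.snd
  snd := d.fst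
  pair z y := d.pair y z
  r := d.r
  fst_mem := d.snd_mem
  snd_mem := d.fst_mem
  pair_mem z hz y hy := d.pair_mem y hy z hz
  fst_pair z hz y hy := d.snd_pair y hy z hz
  snd_pair z hz y hy := d.fst_pair y hy z hz
  pair_fst_snd := d.pair_fst_snd
  fst_local := d.snd_local
  snd_local := d.fst_local
  pair_local z hz z' hz' y hy y' hy' i h h' := d.pair_local y hy y' hy' z hz z' hz' i h' h
  fst_shift := d.snd_shift
  snd_shift := d.fst_shift

/-- Some sequence in `Y` is left asymptotic to `y` and right asymptotic to `y'`. -/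
def Heteroclinic (Y : Set (ℤ → B)) (y y' : ℤ → B) : Prop :=
  ∃ w ∈ Y, ∃ a b : ℤ, (∀ i < a, w i = y i) ∧ ∀ i ≥ b, w i = y' i

/-- A property of points of a closed set that depends on finitely many coordinates defines a closed
set. -/
theorem isClosed_of_local [TopologicalSpace A] [DiscreteTopology A] {X : Set (ℤ → A)}
    (hX : IsClosed X) {P : (ℤ → A) → Prop} (s : Finset ℤ)
    (hP : ∀ x ∈ X, ∀ x' ∈ X, (∀ j ∈ s, x j = x' j) → P x → P x') :
    IsClosed {x ∈ X | P x} := by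
  have hc : Continuous fun (x : ℤ → A) (j : s) => x j := by fun_prop
  have h := (isClosed_discrete {v : s → A | ∃ x ∈ X, P x ∧ ∀ j : s, v j = x j}).preimage hc
  convert hX.inter h using 1
  ext x
  constructor
  · rintro ⟨hx, hPx⟩
    exact ⟨hx, x, hx, hPx, fun _ => rfl⟩
  · rintro ⟨hx, x', hx', hPx', hxx'⟩
    exact ⟨hx, hP x' hx' x hx (fun j hj => (hxx' ⟨j, hj⟩).symm) hPx'⟩

end Decomposition

/-! ### Locality of the inverse of a conjugacy -/

section Inverse

variable {A B : Type*} [TopologicalSpace A] [DiscreteTopology A] [Finite A]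

/-- The inverse of a bijective sliding block code is local. -/
theorem IsSlidingBlockCode.exists_inverse_radius {X : Set (ℤ → A)} {Y : Set (ℤ → B)} {F : X → Y}
    (hF : IsSlidingBlockCode F) (hX : IsClosed X) (hinj : Function.Injective F) :
    ∃ r : ℕ, ∀ x x' : X, (∀ j : ℤ, -r ≤ j → j ≤ r → (F x : ℤ → B) j = (F x' : ℤ → B) j) →
      (x : ℤ → A) 0 = (x' : ℤ → A) 0 := by
  obtain ⟨m, a, -, f, hf⟩ := hF
  by_contra! hcon
  have : CompactSpace X := isCompact_iff_compactSpace.1 hX.isCompact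
  have hcoord : ∀ j, Continuous fun x : X => (x : ℤ → A) j := fun j =>
    (continuous_apply j).comp continuous_subtype_val
  have hcont : ∀ j, IsClosed {q : X × X | (F q.1 : ℤ → B) j = (F q.2 : ℤ → B) j} := by
    intro j
    let res : X × X → (Set.Icc m a → A) × (Set.Icc m a → A) := fun q =>
      (fun k => (q.1 : ℤ → A) (j + k), fun k => (q.2 : ℤ → A) (j + k))
    have hres : Continuous res :=
      (continuous_pi fun k : Set.Icc m a => (hcoord (j + k)).comp continuous_fst).prodMk
        (continuous_pi fun k : Set.Icc m a => (hcoord (j + k)).comp continuous_snd)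
    have h := (isClosed_discrete {v : (Set.Icc m a → A) × (Set.Icc m a → A) |
      f v.1 = f v.2}).preimage hres
    convert h using 1
    ext q
    simp only [Set.mem_ofPred_eq, Set.mem_preimage, hf, res]
  have hne0 : IsClosed {q : X × X | (q.1 : ℤ → A) 0 ≠ (q.2 : ℤ → A) 0} := by
    have hres : Continuous fun q : X × X => ((q.1 : ℤ → A) 0, (q.2 : ℤ → A) 0) :=
      ((hcoord 0).comp continuous_fst).prodMk ((hcoord 0).comp continuous_snd)
    exact (isClosed_discrete {v : A × A | v.1 ≠ v.2}).preimage hres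
  -- If no radius worked, these nested closed sets of pairs would all be nonempty. A common pair has
  -- equal images but different symbols at 0, against injectivity.
  let E : ℕ → Set (X × X) := fun r =>
    (⋂ j ∈ Set.Icc (-r : ℤ) r, {q : X × X | (F q.1 : ℤ → B) j = (F q.2 : ℤ → B) j}) ∩
      {q : X × X | (q.1 : ℤ → A) 0 ≠ (q.2 : ℤ → A) 0}
  have hcl : ∀ r, IsClosed (E r) := fun r =>
    (isClosed_biInter fun j _ => hcont j).inter hne0
  have hmono : ∀ r, E (r + 1) ⊆ E r := fun r =>
    Set.inter_subset_inter_left _ (Set.biInter_subset_biInter_left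
      (Set.Icc_subset_Icc (by push_cast; omega) (by push_cast; omega)))
  have hne : ∀ r, (E r).Nonempty := by
    intro r
    obtain ⟨x, x', h, h0⟩ := hcon r
    exact ⟨(x, x'), Set.mem_iInter₂.2 fun j hj => h j hj.1 hj.2, h0⟩
  obtain ⟨⟨x, x'⟩, hq⟩ := IsCompact.nonempty_iInter_of_sequence_nonempty_isCompact_isClosed E
    hmono hne (hcl 0).isCompact hcl
  rw [Set.mem_iInter] at hq
  refine (hq 0).2 (congrArg (fun x : X => (x : ℤ → A) 0) (hinj (Subtype.ext (funext fun j => ?_))))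
  exact Set.mem_iInter₂.1 (hq j.natAbs).1 j ⟨by omega, by omega⟩

end Inverse

/-! ### From a conjugacy to a product decomposition -/

section OfConjugate

variable {A B C : Type*} [TopologicalSpace A] [DiscreteTopology A] [Finite A]
  [TopologicalSpace B] [TopologicalSpace C]

/-- A conjugacy with a product of subshifts gives a product decomposition. -/
theorem Conjugate.nonempty_productDecomposition {X : Subshift A ℤ} {Y : Subshift B ℤ}
    {Z : Subshift C ℤ} (hX : X.carrier.Nonempty) (h : Conjugate X (prodSubshift Y Z)) :
    Nonempty (ProductDecomposition X.carrier Y.carrier Z.carrier) := by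
  classical
  obtain ⟨F, hF, hblock⟩ := h
  obtain ⟨r₁, hr₁⟩ := hblock.exists_inverse_radius X.isClosed hF.1
  obtain ⟨m, a, -, f, hf⟩ := hblock
  have hshift : ∀ (x : X.carrier) (k : ℤ),
      (F ⟨shift k x, X.mapsTo k x.2⟩ : ℤ → B × C) = shift k (F x : ℤ → B × C) := by
    intro x k
    funext i
    rw [shift_apply, hf, hf]
    simp only [shift_apply, add_assoc]
  let x₀ : X.carrier := ⟨hX.some, hX.some_mem⟩
  -- Points outside the subshift get the default value `x₀`, which no field of the decomposition
  -- sees.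
  let toX : (ℤ → A) → X.carrier := fun x => if h : x ∈ X.carrier then ⟨x, h⟩ else x₀
  have toX_of : ∀ x (h : x ∈ X.carrier), toX x = ⟨x, h⟩ := fun x h => dif_pos h
  let G : (prodSubshift Y Z).carrier → X.carrier := Function.surjInv hF.2
  have hFG : ∀ v, F (G v) = v := Function.surjInv_eq hF.2
  have hGF : ∀ x, G (F x) = x := fun x => hF.1 (hFG _)
  let mk : (ℤ → B) → (ℤ → C) → (prodSubshift Y Z).carrier := fun y z =>
    if h : y ∈ Y.carrier ∧ z ∈ Z.carrier then ⟨fun i => (y i, z i), h⟩ else F x₀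
  have mk_of : ∀ y (hy : y ∈ Y.carrier) z (hz : z ∈ Z.carrier),
      mk y z = ⟨fun i => (y i, z i), ⟨hy, hz⟩⟩ := fun y hy z hz => dif_pos ⟨hy, hz⟩
  let r : ℕ := m.natAbs + a.natAbs + r₁
  have hlocF : ∀ x x' : X.carrier, ∀ i : ℤ,
      (∀ j, i - r ≤ j → j ≤ i + r → (x : ℤ → A) j = (x' : ℤ → A) j) →
      (F x : ℤ → B × C) i = (F x' : ℤ → B × C) i := by
    intro x x' i hxx'
    rw [hf, hf]
    congr 1
    funext j
    have h1 := j.2.1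
    have h2 := j.2.2
    exact hxx' _ (by omega) (by omega)
  have hlocG : ∀ v v' : (prodSubshift Y Z).carrier, ∀ i : ℤ,
      (∀ j, i - r ≤ j → j ≤ i + r → (v : ℤ → B × C) j = (v' : ℤ → B × C) j) →
      (G v : ℤ → A) i = (G v' : ℤ → A) i := by
    intro v v' i hvv'
    have h := hr₁ ⟨shift i (G v), X.mapsTo i (G v).2⟩ ⟨shift i (G v'), X.mapsTo i (G v').2⟩
      (fun j h1 h2 => by
        rw [hshift, hshift, shift_apply, shift_apply, hFG, hFG]
        exact hvv' _ (by omega) (by omega))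
    simpa using h
  refine ⟨{
    fst := fun x i => ((F (toX x) : ℤ → B × C) i).1
    snd := fun x i => ((F (toX x) : ℤ → B × C) i).2
    pair := fun y z => G (mk y z)
    r := r
    fst_mem := fun x _ => (F (toX x)).2.1
    snd_mem := fun x _ => (F (toX x)).2.2
    pair_mem := fun y _ z _ => (G (mk y z)).2
    fst_pair := fun y hy z hz => by
      rw [toX_of _ (G (mk y z)).2, Subtype.coe_eta, hFG, mk_of y hy z hz]
    snd_pair := fun y hy z hz => by
      rw [toX_of _ (G (mk y z)).2, Subtype.coe_eta, hFG, mk_of y hy z hz]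
    pair_fst_snd := fun x hx => by
      rw [mk_of _ (F (toX x)).2.1 _ (F (toX x)).2.2]
      simp only [Prod.mk.eta, Subtype.coe_eta]
      rw [hGF, toX_of x hx]
    fst_local := fun x hx x' hx' i h => by
      rw [toX_of x hx, toX_of x' hx', hlocF ⟨x, hx⟩ ⟨x', hx'⟩ i h]
    snd_local := fun x hx x' hx' i h => by
      rw [toX_of x hx, toX_of x' hx', hlocF ⟨x, hx⟩ ⟨x', hx'⟩ i h]
    pair_local := fun y hy y' hy' z hz z' hz' i h h' => by
      refine hlocG _ _ i fun j h1 h2 => ?_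
      rw [mk_of y hy z hz, mk_of y' hy' z' hz']
      exact Prod.ext (h j h1 h2) (h' j h1 h2)
    fst_shift := fun x hx k => by
      funext i
      rw [toX_of x hx, toX_of _ (X.mapsTo k hx), hshift ⟨x, hx⟩ k, shift_apply, shift_apply]
    snd_shift := fun x hx k => by
      funext i
      rw [toX_of x hx, toX_of _ (X.mapsTo k hx), hshift ⟨x, hx⟩ k, shift_apply, shift_apply] }⟩

end OfConjugate

/-! ### Decompositions of the Dyck shift -/

section DyckDecomposition

variable {n : ℕ} {B C : Type*} {Y : Set (ℤ → B)} {Z : Set (ℤ → C)}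

/-- In a shift-invariant closed set of sequences all of whose right rays go below their start, the
stack height is bounded. -/
theorem exists_heightChange_le {K : Set (ℤ → Bracket n)} (hK : IsClosed K)
    (hinv : ∀ x ∈ K, ∀ k : ℤ, shift k x ∈ K) (hdesc : ∀ x ∈ K, ∃ m : ℕ, heightChange x 0 m < 0) :
    ∃ L : ℕ, ∀ x ∈ K, ∀ (i : ℤ) (k : ℕ), heightChange x i k ≤ L := by
  -- By compactness the time needed to descend below the start is uniformly bounded.
  have hL : ∃ L : ℕ, ∀ x ∈ K, ∃ m ≤ L, heightChange x 0 m < 0 := by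
    by_contra! hcon
    let E : ℕ → Set (ℤ → Bracket n) := fun L => {x ∈ K | ∀ m ≤ L, 0 ≤ heightChange x 0 m}
    have hcl : ∀ L, IsClosed (E L) := fun L =>
      isClosed_of_local hK ((Finset.range L).image fun j : ℕ => (j : ℤ))
        fun x _ x' _ hxx' hx m hm => by
          have e : heightChange x' 0 m = heightChange x 0 m :=
            Finset.sum_congr rfl fun j hj => by
              have hj := Finset.mem_range.1 hj
              rw [hxx' (0 + j) (Finset.mem_image.2 ⟨j, Finset.mem_range.2 (by omega), by simp⟩)]
          rw [e]
          exact hx m hm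
    have hmono : ∀ L, E (L + 1) ⊆ E L := fun L x hx => ⟨hx.1, fun m hm => hx.2 m (by omega)⟩
    have hne : ∀ L, (E L).Nonempty := fun L => by
      obtain ⟨x, hx, h⟩ := hcon L
      exact ⟨x, hx, h⟩
    obtain ⟨x, hx⟩ := IsCompact.nonempty_iInter_of_sequence_nonempty_isCompact_isClosed E
      hmono hne (hcl 0).isCompact hcl
    rw [Set.mem_iInter] at hx
    obtain ⟨m, hm⟩ := hdesc x (hx 0).1
    exact absurd ((hx m).2 m le_rfl) (not_le.2 hm)
  obtain ⟨L, hL⟩ := hL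
  refine ⟨L, fun x hx i k => ?_⟩
  induction k using Nat.strong_induction_on generalizing i with
  | _ k ih =>
    -- A short window climbs at most its length; a longer one loses a descending prefix of length at
    -- most `L`, which only increases the height change.
    by_cases hk : k ≤ L
    · exact (heightChange_le x i k).trans (by exact_mod_cast hk)
    · obtain ⟨m, hm, hneg⟩ := hL _ (hinv x hx i)
      have e : heightChange (shift i x) 0 m = heightChange x i m := by
        simp only [heightChange, shift_apply, zero_add]
      rw [e] at hneg
      have hm0 : m ≠ 0 := by
        rintro rfl
        simp [heightChange] at hneg
      obtain ⟨l, rfl⟩ : ∃ l, k = m + l := ⟨k - m, by omega⟩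
      rw [heightChange_add]
      have := ih l (by omega) (i + m)
      omega

/-- If the first coordinate of a point `x₁` is not heteroclinic to that of a fixed point `x₂`, then
the sequences with the first coordinate of `x₂` have bounded stack height. -/
theorem ProductDecomposition.exists_heightChange_le (hn : 0 < n)
    (D : ProductDecomposition (dyckShift n).carrier Y Z) {x₁ x₂ : ℤ → Bracket n}
    (hx₁ : x₁ ∈ (dyckShift n).carrier) (hx₂ : x₂ ∈ (dyckShift n).carrier)
    (hfix : ∀ k : ℤ, shift k x₂ = x₂)
    (h : ¬ Heteroclinic Y (D.fst x₁) (D.fst x₂)) :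
    ∃ L : ℕ, ∀ z ∈ Z, ∀ (i : ℤ) (k : ℕ), heightChange (D.pair (D.fst x₂) z) i k ≤ L := by
  have hclosed : IsClosed {x ∈ (dyckShift n).carrier | D.fst x = D.fst x₂} := by
    have e : {x ∈ (dyckShift n).carrier | D.fst x = D.fst x₂} =
        ⋂ i : ℤ, {x ∈ (dyckShift n).carrier | D.fst x i = D.fst x₂ i} := by
      ext x
      simp only [Set.mem_ofPred_eq, Set.mem_iInter, funext_iff]
      exact ⟨fun hx i => ⟨hx.1, hx.2 i⟩, fun hx => ⟨(hx 0).1, fun i => (hx i).2⟩⟩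
    rw [e]
    refine isClosed_iInter fun i => isClosed_of_local (dyckShift n).isClosed
      (Finset.Icc (i - D.r) (i + D.r)) fun x hx x' hx' hxx' hi => ?_
    rw [← hi]
    exact (D.fst_local x hx x' hx' i fun j h1 h2 => hxx' j (Finset.mem_Icc.2 ⟨h1, h2⟩)).symm
  obtain ⟨L, hL⟩ := SymbolicDynamics.exists_heightChange_le hclosed
    (fun x hx k => ⟨(dyckShift n).mapsTo k hx.1, by
      rw [D.fst_shift x hx.1, hx.2, ← D.fst_shift x₂ hx₂, hfix]⟩)
    (fun x hx => by
      by_contra! hcon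
      -- A ray that never descends needs no gap (`N = 0`), so it can follow the left ray of `x₁`;
      -- the first coordinate of the result is the excluded connection.
      obtain ⟨w, hw, hwl, hwr⟩ := exists_glue_of_heightChange_ge hn (a := 0) (N := 0) hx₁ hx.1
        (fun m => by simpa using hcon m)
      refine h ⟨D.fst w, D.fst_mem w hw, -D.r, D.r, fun i hi => ?_, fun i hi => ?_⟩
      · exact D.fst_local w hw x₁ hx₁ i fun j _ h2 => hwl j (by push_cast; omega)
      · rw [← hx.2]
        exact D.fst_local w hw x hx.1 i fun j h1 _ => hwr j (by omega))
  exact ⟨L, fun z hz i k => hL _ ⟨D.pair_mem _ (D.fst_mem x₂ hx₂) z hz,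
    D.fst_pair _ (D.fst_mem x₂ hx₂) z hz⟩ i k⟩

/-- Under the same assumption, the second factor has uniform gluing. -/
theorem ProductDecomposition.exists_uniform_glue (hn : 0 < n)
    (D : ProductDecomposition (dyckShift n).carrier Y Z) {x₁ x₂ : ℤ → Bracket n}
    (hx₁ : x₁ ∈ (dyckShift n).carrier) (hx₂ : x₂ ∈ (dyckShift n).carrier)
    (hfix : ∀ k : ℤ, shift k x₂ = x₂) (h : ¬ Heteroclinic Y (D.fst x₁) (D.fst x₂)) :
    ∃ N : ℕ, ∀ z ∈ Z, ∀ z' ∈ Z, ∀ a : ℤ,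
      ∃ w ∈ Z, (∀ i < a, w i = z i) ∧ ∀ i ≥ a + N, w i = z' i := by
  obtain ⟨L, hL⟩ := D.exists_heightChange_le hn hx₁ hx₂ hfix h
  -- The gap in the Dyck shift is `L`; locality of `snd` costs a further `D.r` on each side.
  refine ⟨L + 2 * D.r, fun z hz z' hz' a => ?_⟩
  have hy := D.fst_mem x₂ hx₂
  obtain ⟨w, hw, hwl, hwr⟩ := exists_glue_of_heightChange_le hn (a := a + D.r)
    (D.pair_mem _ hy z hz) (D.pair_mem _ hy z' hz') fun m => hL z hz _ m
  refine ⟨D.snd w, D.snd_mem w hw, fun i hi => ?_, fun i hi => ?_⟩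
  · rw [← D.snd_pair _ hy z hz]
    exact D.snd_local w hw _ (D.pair_mem _ hy z hz) i fun j _ h2 => hwl j (by omega)
  · rw [← D.snd_pair _ hy z' hz']
    push_cast at hi
    exact D.snd_local w hw _ (D.pair_mem _ hy z' hz') i fun j h1 _ => hwr j (by omega)

/-- Under the same assumption, the second factor is a singleton. -/
theorem ProductDecomposition.exists_eq_singleton (hn : 0 < n) {c d : Fin n} (hcd : c ≠ d)
    (D : ProductDecomposition (dyckShift n).carrier Y Z)
    (hZ : ∀ z ∈ Z, ∀ k : ℤ, shift k z ∈ Z) {x₁ x₂ : ℤ → Bracket n}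
    (hx₁ : x₁ ∈ (dyckShift n).carrier) (hx₂ : x₂ ∈ (dyckShift n).carrier)
    (hfix : ∀ k : ℤ, shift k x₂ = x₂) (h : ¬ Heteroclinic Y (D.fst x₁) (D.fst x₂)) :
    ∃ z, Z = {z} := by
  obtain ⟨N, hN⟩ := D.exists_uniform_glue hn hx₁ hx₂ hfix h
  -- The splice below alters only coordinates in [r, r + 2N]; a margin `r` on each side keeps its
  -- effect under `pair` inside [0, M).
  let M : ℕ := 2 * D.r + 2 * N + 1
  let x := mountain c d M
  have hx : x ∈ (dyckShift n).carrier := mountain_mem hn c d M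
  have hz := D.snd_mem x hx
  have hy := D.fst_mem x hx
  have key : ∀ u ∈ Z, u (D.r + N) = D.snd x (D.r + N) := by
    intro u hu
    -- Two gluings: leave `D.snd x` at `r` to reach `u` at `r + N`, then return to `D.snd x` from `r
    -- + 2N + 1` on.
    obtain ⟨v, hv, hvl, hvr⟩ := hN _ hz u hu D.r
    obtain ⟨w, hw, hwl, hwr⟩ := hN v hv _ hz (D.r + N + 1)
    have hxw : D.pair (D.fst x) w = x := by
      refine eq_mountain hn hcd (D.pair_mem _ hy w hw) fun i hi => ?_
      change _ = x i
      conv_rhs => rw [← D.pair_fst_snd x hx]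
      refine D.pair_local _ hy _ hy w hw _ hz i (fun _ _ _ => rfl) fun j h1 h2 => ?_
      rcases hi with hi | hi
      · rw [hwl j (by omega), hvl j (by omega)]
      · exact hwr j (by omega)
    rw [← hvr _ le_rfl, ← hwl _ (by omega), ← D.snd_pair _ hy w hw, hxw]
  refine ⟨D.snd x, Set.eq_singleton_iff_unique_mem.2 ⟨hz, fun u hu => funext fun i => ?_⟩⟩
  have h1 := key _ (hZ u hu (i - (D.r + N)))
  have h2 := key _ (hZ _ hz (i - (D.r + N)))
  rw [shift_apply, sub_add_cancel] at h1 h2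
  rw [h1, h2]

/-- The constant sequences of left brackets of one kind and of right brackets of another kind are
not heteroclinic in one of the factors. -/
theorem ProductDecomposition.not_heteroclinic (hn : 0 < n) {c d : Fin n} (hcd : c ≠ d)
    (D : ProductDecomposition (dyckShift n).carrier Y Z) :
    ¬ Heteroclinic Y (D.fst fun _ => Sum.inl d) (D.fst fun _ => Sum.inr c) ∨
      ¬ Heteroclinic Z (D.snd fun _ => Sum.inl d) (D.snd fun _ => Sum.inr c) := by
  by_contra! hcon
  obtain ⟨⟨y, hy, a, b, hyl, hyr⟩, ⟨z, hz, a', b', hzl, hzr⟩⟩ := hcon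
  have hl := const_inl_mem hn d
  have hr := const_inr_mem hn c
  -- The paired connections agree with the constant sequences once the windows of radius `D.r` lie
  -- in the tails of both factors.
  refine hcd (eq_of_asymptotic_const hn (D.pair_mem y hy z hz) (a := min a a' - D.r)
    (b := max b b' + D.r) (fun i hi => ?_) fun i hi => ?_).symm
  · have e := congrFun (D.pair_fst_snd _ hl) i
    rw [← e]
    exact D.pair_local y hy _ (D.fst_mem _ hl) z hz _ (D.snd_mem _ hl) i
      (fun j _ h2 => hyl j (by omega)) fun j _ h2 => hzl j (by omega)
  · have e := congrFun (D.pair_fst_snd _ hr) i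
    rw [← e]
    exact D.pair_local y hy _ (D.fst_mem _ hr) z hz _ (D.snd_mem _ hr) i
      (fun j h1 _ => hyr j (by omega)) fun j h1 _ => hzr j (by omega)

end DyckDecomposition

end SymbolicDynamics

theorem mainTheorem2 (n : ℕ) (hn : 1 < n) :
    SymbolicDynamics.IsDirectPrime.{0, v, w} (SymbolicDynamics.dyckShift n) := by
  intro B _ _ _ C _ _ _ Y Z _ _ hconj
  have hn0 : 0 < n := by omega
  let c : Fin n := ⟨0, by omega⟩
  let d : Fin n := ⟨1, hn⟩
  have hcd : c ≠ d := by simp [c, d]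
  have hl := SymbolicDynamics.const_inl_mem hn0 d
  have hr := SymbolicDynamics.const_inr_mem hn0 c
  obtain ⟨D⟩ := hconj.nonempty_productDecomposition ⟨_, hl⟩
  -- A missing connection in one factor makes the other factor trivial.
  rcases D.not_heteroclinic hn0 hcd with h | h
  · exact Or.inr (D.exists_eq_singleton hn0 hcd (fun z hz k => Z.mapsTo k hz) hl hr
      (fun _ => rfl) h)
  · exact Or.inl (D.swap.exists_eq_singleton hn0 hcd (fun y hy k => Y.mapsTo k hy) hl hr
      (fun _ => rfl) h)
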